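/- For a totally ordered abelian group $G$ let $\Delta(G)$ be the MV-algebra $\Gamma(\mathbb Z\times_{\mathrm{lex}}G,(1,0))$, i.e. the interval $[(0,0),(1,0)]$ of the lexicographic product $\mathbb Z\times_{\mathrm{lex}}G$ with $0:=(0,0)$, $1:=(1,0)$, $x\oplus y=\min(x+y,(1,0))$ and $\neg x=(1,0)-x$. Let $\mathrm{Perf}^{\mathbb Q}$ be the class of all structures for the language $\{\oplus,\neg,0,1\}$ of MV-algebras that are isomorphic to $\Delta(G)$ for some subgroup $G$ of $\mathbb Q$ with the induced order (the trivial subgroup included). A geometric formula in finitely many variables is one built from atomic formulas (including equations) by finite conjunctions (including the empty one $\top$), disjunctions of arbitrary set-indexed families (including the empty one $\bot$), and existential quantification. A geometric theory is a set of axioms of the form $\forall x_1\cdots\forall x_n\,(\varphi\to\psi)$ with $\varphi,\psi$ geometric formulas in the variables $x_1,\dots,x_n$. Theorem. The class $\mathrm{Perf}^{\mathbb Q}$ is geometric in the language of MV-algebras: there is a geometric theory $T$ in this language such that a structure $M$ for the language is a model of $T$ if and only if $M\in\mathrm{Perf}^{\mathbb Q}$. -/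

import Mathlib

section GeometricLogic

universe u v w x

/-- Geometric formulas over the (one-sorted) first-order language `L` in the finite context of
variables `x₀, …, xₙ₋₁`: they are built from equalities and atomic relations by finite
conjunctions, disjunctions of arbitrary set-indexed families, and existential quantification.
(The formula `⊥` is the empty disjunction.) -/
inductive GeomFormula (L : FirstOrder.Language.{u, v}) : ℕ → Type (max u v (w + 1)) where
  | equal {n : ℕ} (s t : L.Term (Fin n)) : GeomFormula L n
  | rel {n k : ℕ} (R : L.Relations k) (ts : Fin k → L.Term (Fin n)) : GeomFormula L n
  | verum {n : ℕ} : GeomFormula L n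
  | and {n : ℕ} (φ ψ : GeomFormula L n) : GeomFormula L n
  | iOr {n : ℕ} {ι : Type w} (φ : ι → GeomFormula L n) : GeomFormula L n
  | ex {n : ℕ} (φ : GeomFormula L (n + 1)) : GeomFormula L n

/-- Satisfaction of a geometric formula in an `L`-structure under an assignment. -/
def GeomFormula.Realize {L : FirstOrder.Language.{u, v}} {M : Type x} [L.Structure M] :
    {n : ℕ} → GeomFormula.{u, v, w} L n → (Fin n → M) → Prop
  | _, .equal s t, a => s.realize a = t.realize a
  | _, .rel R ts, a => FirstOrder.Language.Structure.RelMap R (fun i => (ts i).realize a)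
  | _, .verum, _ => True
  | _, .and φ ψ, a => φ.Realize a ∧ ψ.Realize a
  | _, .iOr φ, a => ∃ i, (φ i).Realize a
  | _, .ex φ, a => ∃ b : M, φ.Realize (Fin.snoc a b)

/-- A geometric sequent `φ ⊢ ψ` in the context `x₀, …, xₙ₋₁`, where `n = arity`. -/
structure GeomSequent (L : FirstOrder.Language.{u, v}) where
  arity : ℕ
  hyp : GeomFormula.{u, v, w} L arity
  concl : GeomFormula.{u, v, w} L arity

/-- A structure satisfies `φ ⊢ ψ` if `∀ x₀ … xₙ₋₁, φ → ψ` holds in it. -/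
def GeomSequent.Holds {L : FirstOrder.Language.{u, v}} (σ : GeomSequent.{u, v, w} L)
    (M : Type x) [L.Structure M] : Prop :=
  ∀ a : Fin σ.arity → M, σ.hyp.Realize a → σ.concl.Realize a

/-- A geometric theory: a set-indexed family of geometric sequents, its axioms. -/
structure GeomTheory (L : FirstOrder.Language.{u, v}) where
  Index : Type w
  ax : Index → GeomSequent.{u, v, w} L

/-- `M` is a (set-valued) model of the geometric theory `T`. -/
def GeomTheory.IsModel {L : FirstOrder.Language.{u, v}} (T : GeomTheory.{u, v, w} L)
    (M : Type x) [L.Structure M] : Prop :=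
  ∀ i : T.Index, (T.ax i).Holds M

/-- A class of `L`-structures is geometric if it is the class of models of a geometric theory. -/
def IsGeometricClass (L : FirstOrder.Language.{u, v}) (K : (M : Type x) → [L.Structure M] → Prop) : Prop :=
  ∃ T : GeomTheory.{u, v, w} L, ∀ (M : Type x) [L.Structure M], T.IsModel M ↔ K M

end GeometricLogic

/-- MV-algebras `(A, ⊕, ¬, 0, 1)`. -/
class MVAlgebra (A : Type*) where
  oplus : A → A → A
  neg : A → A
  zero : A
  one : A
  oplus_assoc : ∀ x y z, oplus (oplus x y) z = oplus x (oplus y z)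
  oplus_comm : ∀ x y, oplus x y = oplus y x
  oplus_zero : ∀ x, oplus x zero = x
  neg_zero : neg zero = one
  oplus_one : ∀ x, oplus x one = one
  neg_neg : ∀ x, neg (neg x) = x
  lukasiewicz : ∀ x y, oplus (neg (oplus (neg x) y)) y = oplus (neg (oplus (neg y) x)) x

/-- The function symbols `0`, `1`, `¬`, `⊕` of the language of MV-algebras. -/
inductive MVFunc : ℕ → Type
  | zero : MVFunc 0
  | one : MVFunc 0
  | neg : MVFunc 1
  | oplus : MVFunc 2

/-- The first-order language of MV-algebras (equality is logical; no relation symbols). -/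
def mvLanguage : FirstOrder.Language.{0, 0} where
  Functions := MVFunc
  Relations := fun _ => Empty

/-- Every MV-algebra is a structure for the language of MV-algebras. -/
instance MVAlgebra.instStructure (A : Type*) [MVAlgebra A] : mvLanguage.Structure A where
  funMap {_} f a :=
    match f, a with
    | MVFunc.zero, _ => MVAlgebra.zero
    | MVFunc.one, _ => MVAlgebra.one
    | MVFunc.neg, a => MVAlgebra.neg (a 0)
    | MVFunc.oplus, a => MVAlgebra.oplus (a 0) (a 1)
  RelMap {_} r _ := nomatch r

/-- The carrier `[0, u]` of Mundici's `Γ(H, u)`. -/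
abbrev MVGamma {H : Type*} [AddCommGroup H] [Lattice H] (u : H) : Type _ := Set.Icc (0 : H) u

/-- Mundici's MV-algebra `Γ(H, u)`: the interval `[0, u]` of an abelian `ℓ`-group `H` with
`x ⊕ y = (x + y) ⊓ u`, `¬ x = u - x`. -/
abbrev MVGamma.mvAlgebra {H : Type*} [AddCommGroup H] [Lattice H] [IsOrderedAddMonoid H] {u : H}
    (hu : 0 ≤ u) : MVAlgebra (MVGamma u) where
  oplus x y := ⟨(x.1 + y.1) ⊓ u, le_inf (add_nonneg x.2.1 y.2.1) hu, inf_le_right⟩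
  neg x := ⟨u - x.1, sub_nonneg.2 x.2.2, sub_le_self u x.2.1⟩
  zero := ⟨0, le_rfl, hu⟩
  one := ⟨u, hu, le_rfl⟩
  oplus_assoc x y z := by
    apply Subtype.ext
    change ((x.1 + y.1) ⊓ u + z.1) ⊓ u = (x.1 + (y.1 + z.1) ⊓ u) ⊓ u
    rw [inf_add, add_inf, inf_assoc, inf_assoc, inf_eq_right.2 (le_add_of_nonneg_right z.2.1),
      inf_eq_right.2 (le_add_of_nonneg_left x.2.1), add_assoc]
  oplus_comm x y := by
    apply Subtype.ext
    change (x.1 + y.1) ⊓ u = (y.1 + x.1) ⊓ u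
    rw [add_comm]
  oplus_zero x := by
    apply Subtype.ext
    change (x.1 + 0) ⊓ u = x.1
    rw [add_zero, inf_eq_left.2 x.2.2]
  neg_zero := by
    apply Subtype.ext
    change u - 0 = u
    rw [sub_zero]
  oplus_one x := by
    apply Subtype.ext
    change (x.1 + u) ⊓ u = u
    exact inf_eq_right.2 (le_add_of_nonneg_left x.2.1)
  neg_neg x := by
    apply Subtype.ext
    change u - (u - x.1) = x.1
    rw [sub_sub_cancel]
  lukasiewicz x y := by
    have key : ∀ a b : H, u - (u - a + b) ⊓ u + b = a ⊔ b := by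
      intro a b
      rw [sub_eq_add_neg, neg_inf, add_sup, sup_add]
      congr 1 <;> abel
    apply Subtype.ext
    change (u - (u - x.1 + y.1) ⊓ u + y.1) ⊓ u = (u - (u - y.1 + x.1) ⊓ u + x.1) ⊓ u
    rw [key, key, sup_comm]

/-- The carrier of `Δ(G) = Γ(ℤ ×ₗₑₓ G, (1, 0))`. -/
abbrev MVDelta (G : Type*) [AddCommGroup G] [LinearOrder G] : Type _ :=
  MVGamma (H := ℤ ×ₗ G) (toLex (1, 0))

/-- The MV-algebra `Δ(G) = Γ(ℤ ×ₗₑₓ G, (1, 0))` of a totally ordered abelian group `G`. -/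
instance MVDelta.instMVAlgebra (G : Type*) [AddCommGroup G] [LinearOrder G]
    [IsOrderedAddMonoid G] : MVAlgebra (MVDelta G) :=
  MVGamma.mvAlgebra (Prod.Lex.toLex_le_toLex.2 (Or.inl Int.zero_lt_one))

/-- `Perf^ℚ`: the structures isomorphic to the MV-algebra `Δ(G)` for some subgroup `G` of `ℚ`
with the induced order (the trivial subgroup is allowed). -/
def IsPerfQ (M : Type*) [mvLanguage.Structure M] : Prop :=
  ∃ G : AddSubgroup ℚ, Nonempty (FirstOrder.Language.Equiv mvLanguage M (MVDelta G))

universe u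

/-! In `Δ(G)` every element is an infinitesimal `(0, g)` with `g ≥ 0` or the negation `(1, -g)` of
one, so the algebra is governed by the monoid of non-negative elements of `G`. Subgroups of `ℚ` are
singled out by being torsion-free with any two non-negative elements natural multiples of a third.
The latter condition is geometric: it is an existential over a disjunction indexed by `ℕ × ℕ`. The
other axioms split the elements into infinitesimals and their negations, and tabulate `⊕` and `¬`,
mostly on multiples of one infinitesimal. The MV-identities not listed come for free from the
isomorphism with `Δ(G)`.

Conversely, in a model fix an infinitesimal `e ≠ 0`. For an infinitesimal `x` take a common divisor
`z`, with `x = m z` and `e = n z`; by `ratio_unique`, `m / n` depends only on `x`. This measures the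
infinitesimals in `ℚ` (`exists_measure`), injectively. The values generate a subgroup `G`, and `M ≅
Δ(G)` because a common divisor reduces each sum to the tabulated cases. -/

open FirstOrder

/-! ### Invariance of geometric formulas under isomorphism. -/

section Transport

universe v₁ v₂ w x y

variable {L : FirstOrder.Language.{v₁, v₂}} {M : Type x} {N : Type y} [L.Structure M] [L.Structure N]

/-- Isomorphisms preserve and reflect satisfaction of geometric formulas. -/
theorem GeomFormula.realize_equiv (e : L.Equiv M N) {n : ℕ} (φ : GeomFormula.{v₁, v₂, w} L n)
    (a : Fin n → M) : φ.Realize (e ∘ a) ↔ φ.Realize a := by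
  induction φ with
  | equal s t =>
    simp only [GeomFormula.Realize, Language.HomClass.realize_term]
    exact e.injective.eq_iff
  | rel R ts =>
    simp only [GeomFormula.Realize, Language.HomClass.realize_term]
    exact e.map_rel R _
  | verum => simp only [GeomFormula.Realize]
  | and φ ψ hφ hψ => simp only [GeomFormula.Realize, hφ, hψ]
  | iOr φ h => simp only [GeomFormula.Realize, h]
  | ex φ h =>
    simp only [GeomFormula.Realize]
    refine (e.surjective.exists).trans (exists_congr fun b => ?_)
    rw [← h, Fin.comp_snoc]

/-- Isomorphic structures satisfy the same geometric sequents. -/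
theorem GeomSequent.Holds.of_equiv (e : L.Equiv M N) {σ : GeomSequent.{v₁, v₂, w} L}
    (h : σ.Holds N) : σ.Holds M := fun a ha =>
  (σ.concl.realize_equiv e a).1 (h _ ((σ.hyp.realize_equiv e a).2 ha))

/-- Isomorphic structures are models of the same geometric theories. -/
theorem GeomTheory.IsModel.of_equiv (e : L.Equiv M N) {T : GeomTheory.{v₁, v₂, w} L}
    (h : T.IsModel N) : T.IsModel M := fun i => (h i).of_equiv e

end Transport

namespace MVStr

/-! ### MV-operations and the terms denoting them. -/

section Operations

variable {M : Type*} [mvLanguage.Structure M]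

/-- The interpretation of the symbol `0`. -/
def zero : M := Language.Structure.funMap (L := mvLanguage) MVFunc.zero ![]

/-- The interpretation of the symbol `1`. -/
def one : M := Language.Structure.funMap (L := mvLanguage) MVFunc.one ![]

/-- The interpretation of the symbol `¬`. -/
def neg (x : M) : M := Language.Structure.funMap (L := mvLanguage) MVFunc.neg ![x]

/-- The interpretation of the symbol `⊕`. -/
def add (x y : M) : M := Language.Structure.funMap (L := mvLanguage) MVFunc.oplus ![x, y]

/-- The multiples `0, 0 ⊕ z, (0 ⊕ z) ⊕ z, …`. -/
def mul : ℕ → M → M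
  | 0, _ => zero
  | n + 1, z => add (mul n z) z

/-- `¬ x ⊕ ¬ x = 1`; in a perfect MV-algebra this says that `x` is infinitesimal. -/
def Inf (x : M) : Prop := add (neg x) (neg x) = one

end Operations

section Terms

variable {α : Type*}

/-- The term `0`. -/
def tZero : mvLanguage.Term α := .func MVFunc.zero ![]

/-- The term `1`. -/
def tOne : mvLanguage.Term α := .func MVFunc.one ![]

/-- The term `¬ t`. -/
def tNeg (t : mvLanguage.Term α) : mvLanguage.Term α := .func MVFunc.neg ![t]

/-- The term `s ⊕ t`. -/
def tAdd (s t : mvLanguage.Term α) : mvLanguage.Term α := .func MVFunc.oplus ![s, t]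

/-- The term for the `n`-th multiple of `t`. -/
def tMul : ℕ → mvLanguage.Term α → mvLanguage.Term α
  | 0, _ => tZero
  | n + 1, t => tAdd (tMul n t) t

variable {M : Type*} [mvLanguage.Structure M] (v : α → M)

@[simp] theorem realize_tZero : (tZero : mvLanguage.Term α).realize v = zero :=
  congrArg (Language.Structure.funMap (L := mvLanguage) MVFunc.zero) (Subsingleton.elim _ _)

@[simp] theorem realize_tOne : (tOne : mvLanguage.Term α).realize v = one :=
  congrArg (Language.Structure.funMap (L := mvLanguage) MVFunc.one) (Subsingleton.elim _ _)

@[simp] theorem realize_tNeg (t : mvLanguage.Term α) :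
    (tNeg t).realize v = neg (t.realize v) :=
  congrArg (Language.Structure.funMap (L := mvLanguage) MVFunc.neg)
    (funext fun i => by fin_cases i; rfl)

@[simp] theorem realize_tAdd (s t : mvLanguage.Term α) :
    (tAdd s t).realize v = add (s.realize v) (t.realize v) :=
  congrArg (Language.Structure.funMap (L := mvLanguage) MVFunc.oplus)
    (funext fun i => by fin_cases i <;> rfl)

@[simp] theorem realize_tMul (n : ℕ) (t : mvLanguage.Term α) :
    (tMul n t).realize v = mul n (t.realize v) := by
  induction n with
  | zero => exact realize_tZero v
  | succ n ih => rw [tMul, realize_tAdd, ih, mul]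

end Terms

/-! ### The axioms of the geometric theory. -/

/-- The formula `¬ t ⊕ ¬ t = 1`. -/
def fInf {n : ℕ} (t : mvLanguage.Term (Fin n)) : GeomFormula.{0, 0, 0} mvLanguage n :=
  .equal (tAdd (tNeg t) (tNeg t)) tOne

theorem realize_fInf {M : Type*} [mvLanguage.Structure M] {n : ℕ} (t : mvLanguage.Term (Fin n))
    (a : Fin n → M) : (fInf t).Realize a ↔ Inf (t.realize a) := by
  simp [fInf, GeomFormula.Realize, Inf]

/-- Names for the axioms of the geometric theory of `Perf^ℚ`. -/
inductive PerfQAxiom : Type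
  | neg_neg
  | neg_zero
  | add_comm
  | inf_or
  | not_inf_and
  | inf_mul (m : ℕ)
  | mul_add_mul (m n : ℕ)
  | torsion_free (m k : ℕ)
  | common_divisor
  | neg_add_neg
  | neg_mul_add_of_le (m k : ℕ)
  | neg_mul_add (m k : ℕ)

/-- The `i`-th variable as a term. -/
abbrev var {n : ℕ} (i : Fin n) : mvLanguage.Term (Fin n) := .var i

/-- The axioms of the geometric theory of `Perf^ℚ`. -/
def PerfQAxiom.sequent : PerfQAxiom → GeomSequent.{0, 0, 0} mvLanguage
  | .neg_neg => ⟨1, .verum, .equal (tNeg (tNeg (var 0))) (var 0)⟩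
  | .neg_zero => ⟨0, .verum, .equal (tNeg tZero) tOne⟩
  | .add_comm => ⟨2, .verum, .equal (tAdd (var 0) (var 1)) (tAdd (var 1) (var 0))⟩
  | .inf_or => ⟨1, .verum, .iOr (ι := Bool) fun b => cond b (fInf (var 0)) (fInf (tNeg (var 0)))⟩
  | .not_inf_and => ⟨1, .and (fInf (var 0)) (fInf (tNeg (var 0))), .iOr (ι := Empty) Empty.rec⟩
  | .inf_mul m => ⟨1, fInf (var 0), fInf (tMul m (var 0))⟩
  | .mul_add_mul m n => ⟨1, fInf (var 0),
      .equal (tAdd (tMul m (var 0)) (tMul n (var 0))) (tMul (m + n) (var 0))⟩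
  -- The pair `m`, `m + k + 1` runs through all `m < n`; likewise `m`, `m + k` below encodes `m ≤
  -- n`.
  | .torsion_free m k => ⟨1, .and (fInf (var 0)) (.equal (tMul m (var 0)) (tMul (m + k + 1) (var 0))),
      .equal (var 0) tZero⟩
  | .common_divisor => ⟨2, .and (fInf (var 0)) (fInf (var 1)),
      .ex (.and (fInf (var 2)) (.iOr (ι := ℕ × ℕ) fun p =>
        .and (.equal (var 0) (tMul p.1 (var 2))) (.equal (var 1) (tMul p.2 (var 2)))))⟩
  | .neg_add_neg => ⟨2, .and (fInf (var 0)) (fInf (var 1)),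
      .equal (tAdd (tNeg (var 0)) (tNeg (var 1))) tOne⟩
  | .neg_mul_add_of_le m k => ⟨1, fInf (var 0),
      .equal (tAdd (tNeg (tMul m (var 0))) (tMul (m + k) (var 0))) tOne⟩
  | .neg_mul_add m k => ⟨1, fInf (var 0),
      .equal (tAdd (tNeg (tMul (m + k) (var 0))) (tMul m (var 0))) (tNeg (tMul k (var 0)))⟩

/-- The geometric theory of `Perf^ℚ`. -/
def perfQTheory : GeomTheory.{0, 0, 0} mvLanguage := ⟨PerfQAxiom, PerfQAxiom.sequent⟩

/-- The semantic content of the axioms of `perfQTheory`. -/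
structure PerfQLaws (M : Type*) [mvLanguage.Structure M] : Prop where
  neg_neg (x : M) : neg (neg x) = x
  neg_zero : neg (zero : M) = one
  add_comm (x y : M) : add x y = add y x
  inf_or (x : M) : Inf x ∨ Inf (neg x)
  not_inf_and (x : M) : Inf x → ¬ Inf (neg x)
  inf_mul (m : ℕ) {z : M} : Inf z → Inf (mul m z)
  mul_add_mul (m n : ℕ) {z : M} : Inf z → add (mul m z) (mul n z) = mul (m + n) z
  torsion_free (m k : ℕ) {z : M} : Inf z → mul m z = mul (m + k + 1) z → z = zero
  common_divisor {x y : M} : Inf x → Inf y → ∃ z, Inf z ∧ ∃ m n, x = mul m z ∧ y = mul n z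
  neg_add_neg {x y : M} : Inf x → Inf y → add (neg x) (neg y) = one
  neg_mul_add_of_le (m k : ℕ) {z : M} : Inf z → add (neg (mul m z)) (mul (m + k) z) = one
  neg_mul_add (m k : ℕ) {z : M} : Inf z → add (neg (mul (m + k) z)) (mul m z) = neg (mul k z)

section Axioms

variable {M : Type*} [mvLanguage.Structure M]

theorem holds_mk_zero (φ ψ : GeomFormula.{0, 0, 0} mvLanguage 0) :
    (GeomSequent.mk 0 φ ψ).Holds M ↔ (φ.Realize (![] : Fin 0 → M) → ψ.Realize (![] : Fin 0 → M)) :=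
  Unique.forall_iff

theorem holds_mk_one (φ ψ : GeomFormula.{0, 0, 0} mvLanguage 1) :
    (GeomSequent.mk 1 φ ψ).Holds M ↔ ∀ x : M, φ.Realize ![x] → ψ.Realize ![x] :=
  ⟨fun h x => h ![x], fun h a ha => by
    have e : a = ![a 0] := funext fun i => by fin_cases i; rfl
    rw [e] at ha ⊢
    exact h _ ha⟩

theorem holds_mk_two (φ ψ : GeomFormula.{0, 0, 0} mvLanguage 2) :
    (GeomSequent.mk 2 φ ψ).Holds M ↔ ∀ x y : M, φ.Realize ![x, y] → ψ.Realize ![x, y] :=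
  ⟨fun h x y => h ![x, y], fun h a ha => by
    have e : a = ![a 0, a 1] := funext fun i => by fin_cases i <;> rfl
    rw [e] at ha ⊢
    exact h _ _ ha⟩

theorem isModel_perfQTheory_iff : perfQTheory.IsModel M ↔ PerfQLaws M := by
  have h1 : (PerfQAxiom.sequent .neg_neg).Holds M ↔ ∀ x : M, neg (neg x) = x := by
    simp [PerfQAxiom.sequent, holds_mk_one, GeomFormula.Realize]
  have h2 : (PerfQAxiom.sequent .neg_zero).Holds M ↔ neg (zero : M) = one := by
    simp [PerfQAxiom.sequent, holds_mk_zero, GeomFormula.Realize]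
  have h3 : (PerfQAxiom.sequent .add_comm).Holds M ↔ ∀ x y : M, add x y = add y x := by
    simp [PerfQAxiom.sequent, holds_mk_two, GeomFormula.Realize]
  have h4 : (PerfQAxiom.sequent .inf_or).Holds M ↔ ∀ x : M, Inf x ∨ Inf (neg x) := by
    simp [PerfQAxiom.sequent, holds_mk_one, GeomFormula.Realize, realize_fInf, or_comm]
  have h5 : (PerfQAxiom.sequent .not_inf_and).Holds M ↔ ∀ x : M, Inf x → ¬ Inf (neg x) := by
    simp [PerfQAxiom.sequent, holds_mk_one, GeomFormula.Realize, realize_fInf]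
  have h6 (m) : (PerfQAxiom.sequent (.inf_mul m)).Holds M ↔ ∀ z : M, Inf z → Inf (mul m z) := by
    simp [PerfQAxiom.sequent, holds_mk_one, realize_fInf]
  have h7 (m n) : (PerfQAxiom.sequent (.mul_add_mul m n)).Holds M ↔
      ∀ z : M, Inf z → add (mul m z) (mul n z) = mul (m + n) z := by
    simp [PerfQAxiom.sequent, holds_mk_one, GeomFormula.Realize, realize_fInf]
  have h8 (m k) : (PerfQAxiom.sequent (.torsion_free m k)).Holds M ↔
      ∀ z : M, Inf z → mul m z = mul (m + k + 1) z → z = zero := by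
    simp [PerfQAxiom.sequent, holds_mk_one, GeomFormula.Realize, realize_fInf]
  have h9 : (PerfQAxiom.sequent .common_divisor).Holds M ↔ ∀ x y : M, Inf x → Inf y →
      ∃ z, Inf z ∧ ∃ m n, x = mul m z ∧ y = mul n z := by
    simp [PerfQAxiom.sequent, holds_mk_two, GeomFormula.Realize, realize_fInf]
  have h10 : (PerfQAxiom.sequent .neg_add_neg).Holds M ↔
      ∀ x y : M, Inf x → Inf y → add (neg x) (neg y) = one := by
    simp [PerfQAxiom.sequent, holds_mk_two, GeomFormula.Realize, realize_fInf]
  have h11 (m k) : (PerfQAxiom.sequent (.neg_mul_add_of_le m k)).Holds M ↔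
      ∀ z : M, Inf z → add (neg (mul m z)) (mul (m + k) z) = one := by
    simp [PerfQAxiom.sequent, holds_mk_one, GeomFormula.Realize, realize_fInf]
  have h12 (m k) : (PerfQAxiom.sequent (.neg_mul_add m k)).Holds M ↔
      ∀ z : M, Inf z → add (neg (mul (m + k) z)) (mul m z) = neg (mul k z) := by
    simp [PerfQAxiom.sequent, holds_mk_one, GeomFormula.Realize, realize_fInf]
  constructor
  · intro h
    exact ⟨h1.1 (h .neg_neg), h2.1 (h .neg_zero), h3.1 (h .add_comm), h4.1 (h .inf_or),
      h5.1 (h .not_inf_and), fun m => (h6 m).1 (h (.inf_mul m)) _,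
      fun m n => (h7 m n).1 (h (.mul_add_mul m n)) _,
      fun m k => (h8 m k).1 (h (.torsion_free m k)) _, h9.1 (h .common_divisor) _ _,
      h10.1 (h .neg_add_neg) _ _, fun m k => (h11 m k).1 (h (.neg_mul_add_of_le m k)) _,
      fun m k => (h12 m k).1 (h (.neg_mul_add m k)) _⟩
  · rintro h (_ | _ | _ | _ | _ | m | ⟨m, n⟩ | ⟨m, k⟩ | _ | _ | ⟨m, k⟩ | ⟨m, k⟩)
    exacts [h1.2 h.neg_neg, h2.2 h.neg_zero, h3.2 h.add_comm, h4.2 h.inf_or, h5.2 h.not_inf_and,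
      (h6 m).2 fun _ => h.inf_mul m, (h7 m n).2 fun _ => h.mul_add_mul m n,
      (h8 m k).2 fun _ => h.torsion_free m k, h9.2 fun _ _ => h.common_divisor,
      h10.2 fun _ _ => h.neg_add_neg, (h11 m k).2 fun _ => h.neg_mul_add_of_le m k,
      (h12 m k).2 fun _ => h.neg_mul_add m k]

end Axioms

/-! ### Arithmetic in `Δ(G)`. -/

section Delta

variable {G : Type*} [AddCommGroup G] [LinearOrder G] [IsOrderedAddMonoid G]

/-- The infinitesimal `(0, |g|)` of `Δ(G)`. -/
def infinitesimal (g : G) : MVDelta G :=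
  -- The absolute value makes the map total; the computations below take `g ≥ 0`, where it is the
  -- identity.
  ⟨toLex (0, |g|), Prod.Lex.toLex_le_toLex.2 (Or.inr ⟨rfl, abs_nonneg g⟩),
    Prod.Lex.toLex_le_toLex.2 (Or.inl Int.zero_lt_one)⟩

theorem coe_neg (x : MVDelta G) : (neg x).1 = toLex (1, 0) - x.1 := rfl

theorem coe_add (x y : MVDelta G) : (add x y).1 = (x.1 + y.1) ⊓ toLex (1, 0) := rfl

theorem coe_infinitesimal {g : G} (hg : 0 ≤ g) :
    (infinitesimal g).1 = toLex (0, g) := by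
  change toLex ((0 : ℤ), |g|) = _
  rw [abs_of_nonneg hg]

theorem coe_neg_infinitesimal {g : G} (hg : 0 ≤ g) :
    (neg (infinitesimal g)).1 = toLex (1, -g) := by
  rw [coe_neg, coe_infinitesimal hg, ← toLex_sub, Prod.mk_sub_mk, sub_zero, zero_sub]

theorem infinitesimal_zero : infinitesimal (0 : G) = zero :=
  Subtype.ext (coe_infinitesimal le_rfl)

theorem delta_neg_neg (x : MVDelta G) : neg (neg x) = x :=
  Subtype.ext (sub_sub_cancel _ _)

theorem delta_add_comm (x y : MVDelta G) : add x y = add y x :=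
  Subtype.ext (by rw [coe_add, coe_add, add_comm])

theorem infinitesimal_injOn {g h : G} (hg : 0 ≤ g) (hh : 0 ≤ h)
    (e : infinitesimal g = infinitesimal h) : g = h := by
  have := congrArg Subtype.val e
  rw [coe_infinitesimal hg, coe_infinitesimal hh] at this
  exact (Prod.mk.inj (toLex.injective this)).2

theorem infinitesimal_add {g h : G} (hg : 0 ≤ g) (hh : 0 ≤ h) :
    add (infinitesimal g) (infinitesimal h) = infinitesimal (g + h) := by
  apply Subtype.ext
  rw [coe_add, coe_infinitesimal hg, coe_infinitesimal hh, coe_infinitesimal (add_nonneg hg hh),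
    ← toLex_add, Prod.mk_add_mk, add_zero]
  exact inf_eq_left.2 (Prod.Lex.toLex_le_toLex.2 (Or.inl Int.zero_lt_one))

theorem neg_infinitesimal_add_neg {g h : G} (hg : 0 ≤ g) (hh : 0 ≤ h) :
    add (neg (infinitesimal g)) (neg (infinitesimal h)) = one := by
  apply Subtype.ext
  rw [coe_add, coe_neg_infinitesimal hg, coe_neg_infinitesimal hh, ← toLex_add, Prod.mk_add_mk]
  exact inf_eq_right.2 (Prod.Lex.toLex_le_toLex.2 (Or.inl (by norm_num)))

/-- The untruncated sum is `(1, h - g)`, which reaches `(1, 0)` exactly when `g ≤ h`; the next lemma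
is the other case. -/
theorem neg_infinitesimal_add_of_le {g h : G} (hg : 0 ≤ g) (hgh : g ≤ h) :
    add (neg (infinitesimal g)) (infinitesimal h) = one := by
  apply Subtype.ext
  rw [coe_add, coe_neg_infinitesimal hg, coe_infinitesimal (hg.trans hgh), ← toLex_add,
    Prod.mk_add_mk]
  exact inf_eq_right.2 (Prod.Lex.toLex_le_toLex.2 (Or.inr ⟨by simp, by simpa using hgh⟩))

theorem neg_infinitesimal_add {g h : G} (hh : 0 ≤ h) (hgh : h ≤ g) :
    add (neg (infinitesimal g)) (infinitesimal h) = neg (infinitesimal (g - h)) := by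
  apply Subtype.ext
  rw [coe_add, coe_neg_infinitesimal (hh.trans hgh), coe_infinitesimal hh,
    coe_neg_infinitesimal (sub_nonneg.2 hgh), ← toLex_add, Prod.mk_add_mk, add_zero, neg_sub,
    neg_add_eq_sub]
  exact inf_eq_left.2 (Prod.Lex.toLex_le_toLex.2 (Or.inr ⟨rfl, by simpa using hgh⟩))

theorem mul_infinitesimal (n : ℕ) {g : G} (hg : 0 ≤ g) :
    mul n (infinitesimal g) = infinitesimal (n • g) := by
  induction n with
  | zero => rw [zero_smul, infinitesimal_zero, mul]
  | succ n ih => rw [mul, ih, infinitesimal_add (nsmul_nonneg hg n) hg, succ_nsmul]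

/-- Between `(0, 0)` and `(1, 0)` the first coordinate is `0` or `1`, and this fixes the sign of the
second. -/
theorem exists_eq_infinitesimal_or (x : MVDelta G) :
    ∃ g : G, 0 ≤ g ∧ (x = infinitesimal g ∨ x = neg (infinitesimal g)) := by
  obtain ⟨x, h0, h1⟩ := x
  induction x using Lex.rec with | _ x =>
  obtain ⟨k, g⟩ := x
  rcases Prod.Lex.toLex_le_toLex.1 h0 with h0 | ⟨h0, h0'⟩ <;>
  rcases Prod.Lex.toLex_le_toLex.1 h1 with h1 | ⟨h1, h1'⟩ <;> dsimp at *
  · omega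
  · subst h1
    exact ⟨-g, neg_nonneg.2 h1', Or.inr (Subtype.ext
      (by rw [coe_neg_infinitesimal (neg_nonneg.2 h1'), _root_.neg_neg]))⟩
  · subst h0
    exact ⟨g, h0', Or.inl (Subtype.ext (coe_infinitesimal h0').symm)⟩
  · omega

theorem inf_infinitesimal {g : G} (hg : 0 ≤ g) : Inf (infinitesimal g) :=
  neg_infinitesimal_add_neg hg hg

theorem not_inf_neg_infinitesimal {g : G} (hg : 0 ≤ g) : ¬ Inf (neg (infinitesimal g)) := by
  intro h
  rw [Inf, delta_neg_neg, infinitesimal_add hg hg] at h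
  have := congrArg Subtype.val h
  rw [coe_infinitesimal (add_nonneg hg hg)] at this
  exact zero_ne_one (Prod.mk.inj (toLex.injective this)).1

theorem Inf.exists_eq_infinitesimal {x : MVDelta G} (hx : Inf x) :
    ∃ g : G, 0 ≤ g ∧ x = infinitesimal g := by
  obtain ⟨g, hg, rfl | rfl⟩ := exists_eq_infinitesimal_or x
  · exact ⟨g, hg, rfl⟩
  · exact absurd hx (not_inf_neg_infinitesimal hg)

end Delta

/-! ### Subgroups of `ℚ` satisfy the laws. -/

/-- Two non-negative elements of a subgroup of `ℚ` are multiples of a non-negative element. -/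
theorem exists_common_divisor (G : AddSubgroup ℚ) {x y : G} (hx : 0 ≤ x) (hy : 0 ≤ y) :
    ∃ z : G, 0 ≤ z ∧ ∃ m n : ℕ, x = m • z ∧ y = n • z := by
  obtain ⟨x, hxG⟩ := x
  obtain ⟨y, hyG⟩ := y
  have hx : 0 ≤ x := hx
  have hy : 0 ≤ y := hy
  obtain ⟨a, b, d, hd, rfl, rfl⟩ : ∃ a b d : ℕ, d ≠ 0 ∧ x = a / d ∧ y = b / d := by
    lift x to ℚ≥0 using hx
    lift y to ℚ≥0 using hy
    refine ⟨x.num * y.den, y.num * x.den, x.den * y.den, mul_ne_zero x.den_ne_zero y.den_ne_zero,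
      ?_, ?_⟩
    · have := x.den_ne_zero
      have := y.den_ne_zero
      nth_rewrite 1 [← x.num_div_den]
      push_cast
      field_simp
    · have := x.den_ne_zero
      have := y.den_ne_zero
      nth_rewrite 1 [← y.num_div_den]
      push_cast
      field_simp
  -- By Bézout, `gcd(a, b) / d` is an integer combination of `a / d` and `b / d`.
  have hmem : ((Nat.gcd a b : ℕ) : ℚ) / d ∈ G := by
    have := G.add_mem (G.zsmul_mem hxG (Nat.gcdA a b)) (G.zsmul_mem hyG (Nat.gcdB a b))
    convert this using 1
    have h : ((Nat.gcd a b : ℕ) : ℚ) = a * Nat.gcdA a b + b * Nat.gcdB a b := by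
      exact_mod_cast Nat.gcd_eq_gcd_ab a b
    rw [h, zsmul_eq_mul, zsmul_eq_mul]
    ring
  obtain ⟨m, hm⟩ := Nat.gcd_dvd_left a b
  obtain ⟨n, hn⟩ := Nat.gcd_dvd_right a b
  refine ⟨⟨_, hmem⟩, ?_, m, n, Subtype.ext ?_, Subtype.ext ?_⟩
  · change (0 : ℚ) ≤ (Nat.gcd a b : ℕ) / d
    positivity
  · have h : (a : ℚ) = Nat.gcd a b * m := by exact_mod_cast hm
    change (a : ℚ) / d = m • (((Nat.gcd a b : ℕ) : ℚ) / d)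
    rw [nsmul_eq_mul]
    nth_rewrite 1 [h]
    ring
  · have h : (b : ℚ) = Nat.gcd a b * n := by exact_mod_cast hn
    change (b : ℚ) / d = n • (((Nat.gcd a b : ℕ) : ℚ) / d)
    rw [nsmul_eq_mul]
    nth_rewrite 1 [h]
    ring

theorem perfQLaws_delta (G : AddSubgroup ℚ) : PerfQLaws (MVDelta G) where
  neg_neg := delta_neg_neg
  neg_zero := Subtype.ext (sub_zero _)
  add_comm := delta_add_comm
  inf_or x := by
    obtain ⟨g, hg, rfl | rfl⟩ := exists_eq_infinitesimal_or x
    · exact Or.inl (inf_infinitesimal hg)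
    · exact Or.inr (by rw [delta_neg_neg]; exact inf_infinitesimal hg)
  not_inf_and x hx := by
    obtain ⟨g, hg, rfl⟩ := hx.exists_eq_infinitesimal
    exact not_inf_neg_infinitesimal hg
  inf_mul m {z} hz := by
    obtain ⟨g, hg, rfl⟩ := hz.exists_eq_infinitesimal
    rw [mul_infinitesimal m hg]
    exact inf_infinitesimal (nsmul_nonneg hg m)
  mul_add_mul m n {z} hz := by
    obtain ⟨g, hg, rfl⟩ := hz.exists_eq_infinitesimal
    rw [mul_infinitesimal m hg, mul_infinitesimal n hg, mul_infinitesimal _ hg,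
      infinitesimal_add (nsmul_nonneg hg m) (nsmul_nonneg hg n), add_nsmul]
  torsion_free m k {z} hz h := by
    obtain ⟨g, hg, rfl⟩ := hz.exists_eq_infinitesimal
    rw [mul_infinitesimal _ hg, mul_infinitesimal _ hg] at h
    have := infinitesimal_injOn (nsmul_nonneg hg _) (nsmul_nonneg hg _) h
    rw [add_assoc, add_nsmul, left_eq_add] at this
    rw [(nsmul_eq_zero_iff_right k.succ_ne_zero).1 this, infinitesimal_zero]
  common_divisor hx hy := by
    obtain ⟨g, hg, rfl⟩ := hx.exists_eq_infinitesimal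
    obtain ⟨h, hh, rfl⟩ := hy.exists_eq_infinitesimal
    obtain ⟨z, hz, m, n, rfl, rfl⟩ := exists_common_divisor G hg hh
    exact ⟨infinitesimal z, inf_infinitesimal hz, m, n, (mul_infinitesimal m hz).symm,
      (mul_infinitesimal n hz).symm⟩
  neg_add_neg hx hy := by
    obtain ⟨g, hg, rfl⟩ := hx.exists_eq_infinitesimal
    obtain ⟨h, hh, rfl⟩ := hy.exists_eq_infinitesimal
    exact neg_infinitesimal_add_neg hg hh
  neg_mul_add_of_le m k {z} hz := by
    obtain ⟨g, hg, rfl⟩ := hz.exists_eq_infinitesimal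
    rw [mul_infinitesimal _ hg, mul_infinitesimal _ hg]
    exact neg_infinitesimal_add_of_le (nsmul_nonneg hg _)
      (nsmul_le_nsmul_left hg (Nat.le_add_right m k))
  neg_mul_add m k {z} hz := by
    obtain ⟨g, hg, rfl⟩ := hz.exists_eq_infinitesimal
    rw [mul_infinitesimal _ hg, mul_infinitesimal _ hg, mul_infinitesimal _ hg,
      neg_infinitesimal_add (nsmul_nonneg hg _) (nsmul_le_nsmul_left hg (Nat.le_add_right m k)),
      add_nsmul, add_sub_cancel_left]

/-! ### From the laws to a subgroup of `ℚ`. -/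

namespace PerfQLaws

variable {M : Type*} [mvLanguage.Structure M]

/-- If `neg zero` is infinitesimal, then so is its `0`-th multiple, which is `zero`. -/
theorem inf_zero (H : PerfQLaws M) : Inf (zero : M) := by
  rcases H.inf_or (zero : M) with h | h
  · exact h
  · exact H.inf_mul 0 h

theorem mul_mul (H : PerfQLaws M) (m n : ℕ) {z : M} (hz : Inf z) : mul m (mul n z) = mul (m * n) z := by
  induction m with
  | zero => rw [Nat.zero_mul, mul, mul]
  | succ m ih => rw [mul, ih, H.mul_add_mul _ _ hz, Nat.succ_mul]

theorem mul_zero (H : PerfQLaws M) (m : ℕ) : mul m (zero : M) = zero := by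
  simpa [mul] using H.mul_mul m 0 H.inf_zero

theorem mul_left_injective (H : PerfQLaws M) {z : M} (hz : Inf z) (h0 : z ≠ zero) {m n : ℕ}
    (h : mul m z = mul n z) : m = n := by
  rcases lt_trichotomy m n with hmn | hmn | hmn
  · obtain ⟨k, rfl⟩ := Nat.exists_eq_add_of_lt hmn
    exact absurd (H.torsion_free m k hz h) h0
  · exact hmn
  · obtain ⟨k, rfl⟩ := Nat.exists_eq_add_of_lt hmn
    exact absurd (H.torsion_free n k hz h.symm) h0

/-- The ratio of two multiples of an element does not depend on that element. -/
theorem ratio_unique (H : PerfQLaws M) {e z z' : M} (he : e ≠ zero) (hz : Inf z) (hz' : Inf z') {m n m' n' : ℕ}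
    (hm : mul m z = mul m' z') (hn : e = mul n z) (hn' : e = mul n' z') :
    (m : ℚ) / n = m' / n' := by
  -- Measured in units of `w`, the hypotheses become `m a = m' b` and `n a = n' b`.
  obtain ⟨w, hw, a, b, rfl, rfl⟩ := H.common_divisor hz hz'
  have hw0 : w ≠ zero := by
    rintro rfl
    rw [H.mul_zero, H.mul_zero] at hn
    exact he hn
  rw [H.mul_mul _ _ hw] at hn hn'
  rw [H.mul_mul _ _ hw, H.mul_mul _ _ hw] at hm
  have h1 := H.mul_left_injective hw hw0 hm
  have h2 := H.mul_left_injective hw hw0 (hn.symm.trans hn')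
  have hna : n * a ≠ 0 := by
    intro h
    rw [h] at hn
    exact he hn
  have hnb : n' * b ≠ 0 := h2 ▸ hna
  have ha := right_ne_zero_of_mul hna
  have hb := right_ne_zero_of_mul hnb
  have hn0 := left_ne_zero_of_mul hna
  have hn0' := left_ne_zero_of_mul hnb
  have h1q : (m : ℚ) * a = m' * b := by exact_mod_cast h1
  have h2q : (n : ℚ) * a = n' * b := by exact_mod_cast h2
  rw [div_eq_div_iff (by exact_mod_cast hn0) (by exact_mod_cast hn0')]
  have hab : (a : ℚ) * b ≠ 0 := by exact_mod_cast mul_ne_zero ha hb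
  apply mul_right_cancel₀ hab
  linear_combination (n' * b : ℚ) * h1q - (m' * b : ℚ) * h2q

/-- A measure of the infinitesimals by non-negative rational numbers. -/
theorem exists_measure (H : PerfQLaws M) : ∃ f : M → ℚ, (∀ z, Inf z → 0 ≤ f z) ∧
    (∀ z, Inf z → ∀ n, f (mul n z) = n * f z) ∧ ∀ z, Inf z → f z = 0 → z = zero := by
  -- Without a nonzero infinitesimal there is no unit `e`, but the zero function then works.
  by_cases h : ∀ z : M, Inf z → z = zero
  · exact ⟨fun _ => 0, fun _ _ => le_rfl, fun _ _ _ => by simp,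
      fun z hz _ => h z hz⟩
  · push Not at h
    obtain ⟨e, he, he0⟩ := h
    have key : ∀ x : M, Inf x → ∃ q : ℚ, ∃ z : M, ∃ m n : ℕ,
        Inf z ∧ x = mul m z ∧ e = mul n z ∧ q = m / n := by
      intro x hx
      obtain ⟨z, hz, m, n, h1, h2⟩ := H.common_divisor hx he
      exact ⟨_, z, m, n, hz, h1, h2, rfl⟩
    choose! f z m n hz hx hn hf using key
    refine ⟨f, fun x hx' => ?_, fun x hx' k => ?_, fun x hx' h0 => ?_⟩
    · rw [hf x hx']
      positivity
    · have hk := H.inf_mul k hx'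
      rw [hf _ hk, hf x hx', ← mul_div_assoc, ← Nat.cast_mul]
      refine H.ratio_unique he0 (hz _ hk) (hz x hx') ?_ (hn _ hk) (hn x hx')
      rw [← hx _ hk, ← H.mul_mul _ _ (hz x hx'), ← hx x hx']
    · rw [hf x hx', div_eq_zero_iff] at h0
      -- A zero quotient may come from a zero denominator; that would force `e = zero`.
      rcases h0 with h0 | h0
      · rw [hx x hx', Nat.cast_eq_zero.1 h0, mul]
      · have := hn x hx'
        rw [Nat.cast_eq_zero.1 h0] at this
        exact absurd this he0

theorem isPerfQ (H : PerfQLaws M) : IsPerfQ M := by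
  classical
  obtain ⟨f, f_nonneg, f_mul, f_zero⟩ := H.exists_measure
  -- Integer multiples of values supply negatives; common divisors give closure under addition.
  let G : AddSubgroup ℚ :=
    { carrier := {q | ∃ z : M, Inf z ∧ ∃ k : ℤ, q = k * f z}
      zero_mem' := ⟨zero, H.inf_zero, 0, by simp⟩
      add_mem' := by
        rintro _ _ ⟨x, hx, k, rfl⟩ ⟨y, hy, l, rfl⟩
        obtain ⟨z, hz, m, n, rfl, rfl⟩ := H.common_divisor hx hy
        refine ⟨z, hz, k * m + l * n, ?_⟩
        rw [f_mul z hz, f_mul z hz]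
        push_cast
        ring
      neg_mem' := by
        rintro _ ⟨x, hx, k, rfl⟩
        exact ⟨x, hx, -k, by push_cast; ring⟩ }
  have f_mem : ∀ {x}, Inf x → f x ∈ G := fun {x} hx => ⟨x, hx, 1, by simp⟩
  have f_inj : ∀ {x y}, Inf x → Inf y → f x = f y → x = y := by
    intro x y hx hy h
    obtain ⟨z, hz, m, n, rfl, rfl⟩ := H.common_divisor hx hy
    rw [f_mul z hz, f_mul z hz] at h
    rcases mul_eq_mul_right_iff.1 h with h | h
    · rw [Nat.cast_injective h]
    · rw [f_zero z hz h, H.mul_zero, H.mul_zero]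
  have f_surj : ∀ g : G, 0 ≤ g → ∃ x, Inf x ∧ f x = g := by
    rintro ⟨_, z, hz, k, rfl⟩ (hk : (0 : ℚ) ≤ k * f z)
    -- Only natural multiples exist in `M`; if `k < 0`, then `k * f z ≥ 0` forces `f z = 0`, so the
    -- sign of `k` is immaterial.
    refine ⟨mul k.natAbs z, H.inf_mul _ hz, ?_⟩
    rw [f_mul z hz, Nat.cast_natAbs, Int.cast_abs]
    change |(k : ℚ)| * f z = k * f z
    nth_rewrite 1 [← abs_of_nonneg (f_nonneg z hz)]
    rw [← abs_mul, abs_of_nonneg hk]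
  -- The value `0` off the infinitesimals is a dummy: `F` evaluates `g` only at `x` or `neg x`,
  -- whichever is infinitesimal.
  let g : M → G := fun x => if hx : Inf x then ⟨f x, f_mem hx⟩ else 0
  have coe_g : ∀ {x}, Inf x → (g x : ℚ) = f x := fun hx => by simp only [g, dif_pos hx]
  have g_nonneg : ∀ {x}, Inf x → 0 ≤ g x := fun {x} hx => by
    have := f_nonneg x hx
    rw [← coe_g hx] at this
    exact this
  have g_mul : ∀ {z}, Inf z → ∀ n, g (mul n z) = n • g z := fun {z} hz n => by
    apply Subtype.ext
    rw [coe_g (H.inf_mul n hz), f_mul z hz, AddSubgroup.coe_nsmul, coe_g hz, nsmul_eq_mul]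
  let F : M → MVDelta G := fun x =>
    if Inf x then infinitesimal (g x) else neg (infinitesimal (g (neg x)))
  have F_inf : ∀ {x}, Inf x → F x = infinitesimal (g x) := fun hx => if_pos hx
  have F_neg : ∀ {x}, Inf x → F (neg x) = neg (infinitesimal (g x)) := fun {x} hx => by
    simp only [F, if_neg (H.not_inf_and x hx), H.neg_neg]
  have cases_inf : ∀ x : M, ∃ y, Inf y ∧ (x = y ∨ x = neg y) := fun x => by
    rcases H.inf_or x with h | h
    · exact ⟨x, h, Or.inl rfl⟩
    · exact ⟨neg x, h, Or.inr (H.neg_neg x).symm⟩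
  have map_neg : ∀ x, F (neg x) = neg (F x) := fun x => by
    obtain ⟨y, hy, rfl | rfl⟩ := cases_inf x
    · rw [F_neg hy, F_inf hy]
    · rw [F_neg hy, H.neg_neg, F_inf hy, delta_neg_neg]
  have map_zero : F zero = zero := by
    have : g zero = 0 := by simpa [mul] using g_mul H.inf_zero 0
    rw [F_inf H.inf_zero, this, infinitesimal_zero]
  have map_one : F one = one := by
    rw [← H.neg_zero, map_neg, map_zero, (perfQLaws_delta G).neg_zero]
  have map_neg_add : ∀ {x y}, Inf x → Inf y → F (add (neg x) y) = add (F (neg x)) (F y) := by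
    intro x y hx hy
    obtain ⟨z, hz, m, n, rfl, rfl⟩ := H.common_divisor hx hy
    rw [F_neg hx, F_inf hy, g_mul hz, g_mul hz, ← mul_infinitesimal _ (g_nonneg hz),
      ← mul_infinitesimal _ (g_nonneg hz)]
    -- Both sides now involve multiples of a single element, and the same law evaluates them in `M`
    -- and in `Δ(G)`.
    rcases le_total m n with hmn | hmn
    · obtain ⟨k, rfl⟩ := Nat.exists_eq_add_of_le hmn
      rw [H.neg_mul_add_of_le m k hz,
        (perfQLaws_delta G).neg_mul_add_of_le m k (inf_infinitesimal (g_nonneg hz)), map_one]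
    · obtain ⟨k, rfl⟩ := Nat.exists_eq_add_of_le hmn
      rw [H.neg_mul_add n k hz,
        (perfQLaws_delta G).neg_mul_add n k (inf_infinitesimal (g_nonneg hz)),
        F_neg (H.inf_mul k hz), g_mul hz, mul_infinitesimal _ (g_nonneg hz)]
  have map_add : ∀ x y, F (add x y) = add (F x) (F y) := fun x y => by
    obtain ⟨x', hx, rfl | rfl⟩ := cases_inf x <;> obtain ⟨y', hy, rfl | rfl⟩ := cases_inf y
    · obtain ⟨z, hz, m, n, rfl, rfl⟩ := H.common_divisor hx hy
      rw [H.mul_add_mul m n hz, F_inf hx, F_inf hy, F_inf (H.inf_mul _ hz), g_mul hz, g_mul hz,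
        g_mul hz, infinitesimal_add (nsmul_nonneg (g_nonneg hz) m) (nsmul_nonneg (g_nonneg hz) n),
        add_nsmul]
    · rw [H.add_comm, map_neg_add hy hx, delta_add_comm]
    · exact map_neg_add hx hy
    · rw [H.neg_add_neg hx hy, F_neg hx, F_neg hy,
        neg_infinitesimal_add_neg (g_nonneg hx) (g_nonneg hy), map_one]
  have inj_inf : ∀ {x y}, Inf x → Inf y → F x = F y → x = y := fun {x y} hx hy h => by
    rw [F_inf hx, F_inf hy] at h
    have h' := infinitesimal_injOn (g_nonneg hx) (g_nonneg hy) h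
    exact f_inj hx hy (by rw [← coe_g hx, ← coe_g hy, h'])
  have inf_F : ∀ {x}, Inf x → Inf (F x) := fun hx => by
    rw [F_inf hx]
    exact inf_infinitesimal (g_nonneg hx)
  have F_injective : Function.Injective F := by
    intro x y h
    obtain ⟨x', hx, rfl | rfl⟩ := cases_inf x <;> obtain ⟨y', hy, rfl | rfl⟩ := cases_inf y
    · exact inj_inf hx hy h
    -- An infinitesimal and a negated one have distinct images, since no negated infinitesimal of
    -- `Δ(G)` is infinitesimal.
    · rw [F_neg hy] at h
      exact absurd (h ▸ inf_F hx) (not_inf_neg_infinitesimal (g_nonneg hy))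
    · rw [F_neg hx] at h
      exact absurd (h ▸ inf_F hy) (not_inf_neg_infinitesimal (g_nonneg hx))
    · rw [map_neg, map_neg] at h
      rw [inj_inf hx hy (by rw [← delta_neg_neg (F x'), h, delta_neg_neg])]
  have F_surjective : Function.Surjective F := by
    intro u
    obtain ⟨q, hq, hu⟩ := exists_eq_infinitesimal_or u
    obtain ⟨x, hx, hxq⟩ := f_surj q hq
    have hgq : g x = q := Subtype.ext ((coe_g hx).trans hxq)
    rcases hu with rfl | rfl
    · exact ⟨x, by rw [F_inf hx, hgq]⟩
    · exact ⟨neg x, by rw [F_neg hx, hgq]⟩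
  refine ⟨G, ⟨⟨Equiv.ofBijective F ⟨F_injective, F_surjective⟩, ?_, ?_⟩⟩⟩
  · rintro n (_ | _ | _ | _) a
    · rw [Subsingleton.elim a ![] ]
      exact map_zero
    · rw [Subsingleton.elim a ![] ]
      exact map_one
    · rw [show a = ![a 0] from funext fun i => by fin_cases i; rfl]
      exact map_neg (a 0)
    · rw [show a = ![a 0, a 1] from funext fun i => by fin_cases i <;> rfl]
      exact map_add (a 0) (a 1)
  · rintro n ⟨⟩

end PerfQLaws

end MVStr

theorem mainTheorem9 :
    IsGeometricClass.{0, 0, 0, u} mvLanguage (fun (M : Type u) _ => IsPerfQ M) := by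
  refine ⟨MVStr.perfQTheory, fun M _ => ⟨fun h => ?_, ?_⟩⟩
  · exact (MVStr.isModel_perfQTheory_iff.1 h).isPerfQ
  · rintro ⟨G, ⟨e⟩⟩
    exact GeomTheory.IsModel.of_equiv e (MVStr.isModel_perfQTheory_iff.2 (MVStr.perfQLaws_delta G))
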